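/- Let $k\ge 1$ be an integer, $\lambda>0$, and let $H$ be a probability law on $\mathbb R$. On a probability space let $\{N(t)\}_{t\ge0}$ be a Poisson process with rate $k\lambda$, let $X_1,X_2,\dots$ be i.i.d. uniform on $\{1,\dots,k\}$ and independent of $N$, and put $N^{(k)}(t)=\sum_{i=1}^{N(t)}X_i$ (the Poisson process of order $k$). Let $Y_1,Y_2,\dots$ be i.i.d. real random variables with law $H$, independent of the process $N^{(k)}$, and put $Z(t)=\sum_{i=1}^{N^{(k)}(t)}Y_i$ (the compound Poisson process of order $k$). Let $c_1,c_2\ge0$ with $c_1+c_2=1$, $\mu_1,\mu_2>0$, $\alpha_1,\alpha_2\in(0,1)$, and let $\{S(t)\}_{t\ge0}$ be a mixture of tempered stable subordinators, i.e. a nondecreasing Lévy process started at $0$ with $$\mathbb E[e^{-sS(t)}]=\exp\Big\{-t\big(c_1((s+\mu_1)^{\alpha_1}-\mu_1^{\alpha_1})+c_2((s+\mu_2)^{\alpha_2}-\mu_2^{\alpha_2})\big)\Big\},\qquad s>0,\ t\ge 0.$$ Assume that the process $S$ is independent of the pair $(\{N^{(k)}(t)\}_{t\ge0},\{Y_i\}_{i\ge1})$.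 Put $Z_1(t)=Z(S(t))$ and $q_j(t)=\mathbb P[N^{(k)}(S(t))=j]$ for $j=0,1,2,\dots$. Then for all $n$, all times $0=t_0\le t_1\le\dots\le t_n$ and all $y_1,\dots,y_n\in\mathbb R$, with $\Delta t_l=t_l-t_{l-1}$, $$\mathbb P[Z_1(t_1)\le y_1,\dots,Z_1(t_n)\le y_n]=\sum_{j_1,\dots,j_n\ge0}\ \prod_{l=1}^n q_{j_l}(\Delta t_l)\int_{(-\infty,v_1]}\cdots\int_{(-\infty,v_n]}H^{*j_n}(dx_n)\cdots H^{*j_1}(dx_1),$$ where $v_m=y_m-\sum_{l=1}^{m-1}x_l$ and $H^{*j}$ is the $j$-fold convolution of $H$, with $H^{*0}=\delta_0$. In particular, if $H$ has a density $h$ with respect to Lebesgue measure, or a probability mass function $h$ (a density with respect to counting measure), the same identity holds with $H^{*j}(dx)$ replaced, for $j\ge1$, by $h^{*j}(x)\,dx$ (respectively by $h^{*j}(x)$ times counting measure), where $h^{*j}$ is the $j$-fold convolution of the function $h$, and by the unit mass $\delta_0$ for $j=0$. -/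

import Mathlib

open MeasureTheory ProbabilityTheory Set
open scoped NNReal ENNReal

noncomputable section

namespace CPPoK

/-- `N` is a (homogeneous) Poisson process with rate `r`: it starts at `0`, has independent
increments, `N(s + h) - N(s)` is Poisson with mean `r * h`, and almost every path is
nondecreasing and right-continuous (left limits are then automatic). -/
structure IsPoissonProcess {Ω : Type*} [MeasurableSpace Ω] (N : ℝ≥0 → Ω → ℕ) (r : ℝ≥0)
    (P : Measure Ω) : Prop where
  measurable : ∀ t, Measurable (N t)
  zero : ∀ᵐ ω ∂P, N 0 ω = 0
  indep : HasIndepIncrements (fun t ω => (N t ω : ℝ)) P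
  law : ∀ s h : ℝ≥0, HasLaw (fun ω => (N (s + h) ω : ℝ) - (N s ω : ℝ))
    ((poissonMeasure (r * h)).map (Nat.cast : ℕ → ℝ)) P
  paths : ∀ᵐ ω ∂P, Monotone (fun t => N t ω) ∧
    ∀ t, ContinuousWithinAt (fun s => N s ω) (Ici t) t

/-- The random sum `N^{(k)}(t) = X_1 + ... + X_{N(t)}` (`X i` stands for `X_{i+1}`). -/
def orderKProcess {Ω : Type*} (N : ℝ≥0 → Ω → ℕ) (X : ℕ → Ω → ℕ) (t : ℝ≥0) (ω : Ω) : ℕ :=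
  ∑ i ∈ Finset.range (N t ω), X i ω

/-- The data defining the Poisson process of order `k` with parameter `lam`: a Poisson process `N`
with rate `k * lam` and an i.i.d. sequence, independent of `N`, uniform on `{1, ..., k}`.
The process itself is `orderKProcess N X`. -/
structure IsPPoK {Ω : Type*} [MeasurableSpace Ω] (k : ℕ) (lam : ℝ≥0)
    (N : ℝ≥0 → Ω → ℕ) (X : ℕ → Ω → ℕ) (P : Measure Ω) : Prop where
  poisson : IsPoissonProcess N (k * lam) P
  measurable : ∀ i, Measurable (X i)
  indep : iIndepFun X P
  law : ∀ i, HasLaw (X i) (uniformOn (Icc 1 k)) P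
  indep_poisson : IndepFun (fun ω i => X i ω) (fun ω t => N t ω) P

/-- The data defining the compound Poisson process of order `k`: a Poisson process of order `k`
and an i.i.d. real sequence with law `H`, independent of that process. -/
structure IsCPPoK {Ω : Type*} [MeasurableSpace Ω] (k : ℕ) (lam : ℝ≥0) (H : Measure ℝ)
    (N : ℝ≥0 → Ω → ℕ) (X : ℕ → Ω → ℕ) (Y : ℕ → Ω → ℝ) (P : Measure Ω) : Prop where
  ppok : IsPPoK k lam N X P
  measurable : ∀ i, Measurable (Y i)
  indep : iIndepFun Y P
  law : ∀ i, HasLaw (Y i) H P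
  indep_ppok : IndepFun (fun ω i => Y i ω) (fun ω t => orderKProcess N X t ω) P

/-- The compound process `Z(t) = Y_1 + ... + Y_{N^{(k)}(t)}`. -/
def compoundProcess {Ω : Type*} (N : ℝ≥0 → Ω → ℕ) (X : ℕ → Ω → ℕ) (Y : ℕ → Ω → ℝ)
    (t : ℝ≥0) (ω : Ω) : ℝ :=
  ∑ i ∈ Finset.range (orderKProcess N X t ω), Y i ω

/-- A subordinator: a nondecreasing Lévy process. -/
structure IsSubordinator {Ω : Type*} [MeasurableSpace Ω] (S : ℝ≥0 → Ω → ℝ≥0)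
    (P : Measure Ω) : Prop where
  measurable : ∀ t, Measurable (S t)
  zero : ∀ᵐ ω ∂P, S 0 ω = 0
  indep : HasIndepIncrements (fun t ω => (S t ω : ℝ)) P
  stationary : ∀ s h : ℝ≥0,
    IdentDistrib (fun ω => (S (s + h) ω : ℝ) - (S s ω : ℝ)) (fun ω => (S h ω : ℝ)) P P
  paths : ∀ᵐ ω ∂P, Monotone (fun t => S t ω) ∧
    ∀ t, ContinuousWithinAt (fun s => S s ω) (Ici t) t

/-- The Laplace exponent of the mixture of tempered stable subordinators. -/
def mtssExponent (c₁ c₂ α₁ α₂ μ₁ μ₂ s : ℝ) : ℝ :=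
  c₁ * ((s + μ₁) ^ α₁ - μ₁ ^ α₁) + c₂ * ((s + μ₂) ^ α₂ - μ₂ ^ α₂)

/-- `S` is a mixture of tempered stable subordinators: a subordinator with
`E[exp(-s S(t))] = exp(-t f(s))`, where `f` is `mtssExponent`. -/
structure IsMTSS {Ω : Type*} [MeasurableSpace Ω] (c₁ c₂ α₁ α₂ μ₁ μ₂ : ℝ)
    (S : ℝ≥0 → Ω → ℝ≥0) (P : Measure Ω) : Prop where
  subordinator : IsSubordinator S P
  laplace : ∀ (t : ℝ≥0) (s : ℝ), 0 < s →
    ∫ ω, Real.exp (-(s * (S t ω : ℝ))) ∂P =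
      Real.exp (-((t : ℝ) * mtssExponent c₁ c₂ α₁ α₂ μ₁ μ₂ s))

/-- The increments `Δt_l = t_l - t_{l-1}`, with the time before the first one equal to `0`. -/
def timeIncr {n : ℕ} (t : Fin n → ℝ≥0) (l : Fin n) : ℝ≥0 :=
  t l - if 0 < l.val then t ⟨l.val - 1, lt_of_le_of_lt (Nat.sub_le _ _) l.isLt⟩ else 0

/-- The `j`-fold convolution of a law on `ℝ`; the `0`-fold one is the unit mass at `0`. -/
def lawConvPow (H : Measure ℝ) : ℕ → Measure ℝ
  | 0 => Measure.dirac 0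
  | j + 1 => (lawConvPow H j).conv H

/-- The `(j + 1)`-fold convolution, with respect to `ρ`, of the function `h` with itself. -/
def densityConvPow (ρ : Measure ℝ) (h : ℝ → ℝ≥0∞) : ℕ → ℝ → ℝ≥0∞
  | 0 => h
  | j + 1 => lconvolution (densityConvPow ρ h j) h ρ

/-- `h^{*j}(x) ρ(dx)`, where the `0`-fold convolution stands for the unit mass at `0`. -/
def densityConvMeasure (ρ : Measure ℝ) (h : ℝ → ℝ≥0∞) : ℕ → Measure ℝ
  | 0 => Measure.dirac 0
  | j + 1 => ρ.withDensity (densityConvPow ρ h j)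

/-- The iterated integral of the constant `1` against `K_1(dx_1) ... K_n(dx_n)`, where
`x_m` runs over `(-∞, y_m - c - (x_1 + ... + x_{m-1})]`; the integral over `x_1` is outermost. -/
def iteratedIntegral : {n : ℕ} → (Fin n → Measure ℝ) → (Fin n → ℝ) → ℝ → ℝ≥0∞
  | 0, _, _, _ => 1
  | _ + 1, K, y, c =>
    ∫⁻ x in Iic (y 0 - c),
      iteratedIntegral (fun i => K i.succ) (fun i => y i.succ) (c + x) ∂(K 0)

/-- The series `∑_{j_1, ..., j_n ≥ 0} ∏_l q_{j_l}(Δt_l) ∫_{-∞}^{v_1} ... ∫_{-∞}^{v_n} ∏_m K_{j_m}(dx_m)`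
with `v_m = y_m - (x_1 + ... + x_{m-1})`. -/
def fddSeries (q : ℕ → ℝ≥0 → ℝ≥0∞) (K : ℕ → Measure ℝ) {n : ℕ} (t : Fin n → ℝ≥0)
    (y : Fin n → ℝ) : ℝ≥0∞ :=
  ∑' j : Fin n → ℕ, (∏ l, q (j l) (timeIncr t l)) * iteratedIntegral (fun m => K (j m)) y 0

end CPPoK

end

/-! Since `S` is independent of the pair (N^(k), Y), the probability is the average over `S` of the
finite-dimensional distribution of Z at the frozen times S(t_l) (`measure_random_times`). At frozen
times, split by the increments j_l of N^(k). Given them, the increments of Z are sums over disjoint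
blocks of the i.i.d. Y_i, hence independent with laws H^{*j_l} (`measure_stopped_sums`). The same
lemma, applied to the X_i stopped by N, shows that N^(k) has independent stationary increments, so
the weight of j is ∏ p_{j_l}(S(t_l) - S(t_{l-1})), where p_j(h) = P[N^(k)(h) = j]. Averaging over
`S`, independent increments split the mean of the product, and stationarity turns each factor into E
p_j(S(Δt_l)) = q_j(Δt_l). -/

namespace CPPoK

/-! ### Partial sums, blocks of indices, and products of series. -/

section PartialSums

theorem eq_partialSum_iff {n : ℕ} {G : Type*} [AddMonoid G] (f : Fin (n + 1) → G) (a : Fin n → G) :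
    f = Fin.partialSum a ↔ f 0 = 0 ∧ ∀ l : Fin n, f l.succ = f l.castSucc + a l := by
  constructor
  · rintro rfl
    exact ⟨Fin.partialSum_zero a, Fin.partialSum_succ a⟩
  · rintro ⟨h0, hs⟩
    funext l
    induction l using Fin.induction with
    | zero => rw [h0, Fin.partialSum_zero]
    | succ l ih => rw [hs, ih, Fin.partialSum_succ]

theorem monotone_partialSum {n : ℕ} (a : Fin n → ℕ) : Monotone (Fin.partialSum a) :=
  Fin.monotone_iff_le_succ.2 fun l => by rw [Fin.partialSum_succ]; omega

theorem partialSum_succ_injective {n : ℕ} {G : Type*} [AddCancelMonoid G] :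
    Function.Injective fun (a : Fin n → G) (l : Fin n) => Fin.partialSum a l.succ := by
  intro a b h
  have h' : Fin.partialSum a = Fin.partialSum b := by
    funext l
    cases l using Fin.cases with
    | zero => simp
    | succ l => exact congrFun h l
  funext l
  have := congrFun h l
  simp only [Fin.partialSum_succ, h'] at this
  exact add_left_cancel this

theorem sum_range_partialSum {n : ℕ} {G : Type*} [AddCommMonoid G] (x : ℕ → G) (a : Fin n → ℕ)
    (l : Fin (n + 1)) :
    ∑ i ∈ Finset.range (Fin.partialSum a l), x i =
      Fin.partialSum (fun m : Fin n =>
        ∑ j ∈ Finset.range (a m), x (Fin.partialSum a m.castSucc + j)) l := by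
  refine congrFun ((eq_partialSum_iff (fun l => ∑ i ∈ Finset.range (Fin.partialSum a l), x i)
    _).2 ⟨by simp, fun l => ?_⟩) l
  rw [Fin.partialSum_succ, Finset.sum_range_add]

/-- Consecutive blocks of lengths `a l` do not overlap, so an independent sequence can be reindexed
by (block, position). -/
theorem block_injective {n : ℕ} (a : Fin n → ℕ) :
    Function.Injective fun p : (Σ l : Fin n, Fin (a l)) =>
      Fin.partialSum a p.1.castSucc + p.2 := by
  have key : ∀ (l m : Fin n) (i : Fin (a l)) (j : Fin (a m)), l < m →
      Fin.partialSum a l.castSucc + i < Fin.partialSum a m.castSucc + j := by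
    intro l m i j h
    have h1 : Fin.partialSum a l.succ ≤ Fin.partialSum a m.castSucc :=
      monotone_partialSum a (Fin.succ_le_castSucc_iff.2 h)
    rw [Fin.partialSum_succ] at h1
    have := i.2
    omega
  rintro ⟨l, i⟩ ⟨m, j⟩ h
  rcases lt_trichotomy l m with hlm | rfl | hlm
  · exact absurd h (key l m i j hlm).ne
  · have : i = j := by ext; simpa using h
    rw [this]
  · exact absurd h (key m l j i hlm).ne'

theorem tsum_prod_eq_prod_tsum {n : ℕ} (f : Fin n → ℕ → ℝ≥0∞) :
    ∑' a : Fin n → ℕ, ∏ l, f l (a l) = ∏ l, ∑' i, f l i := by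
  induction n with
  | zero => simp
  | succ n ih =>
    rw [← (Fin.consEquiv fun _ : Fin (n + 1) => ℕ).tsum_eq, Fin.prod_univ_succ, ← ih,
      ← ENNReal.tsum_mul_right, ENNReal.tsum_prod']
    simp [Fin.consEquiv, Fin.prod_univ_succ, ENNReal.tsum_mul_left]

theorem measurable_partialSum {n : ℕ} {β : Type*} [AddMonoid β] [MeasurableSpace β]
    [MeasurableAdd₂ β] (m : Fin (n + 1)) :
    Measurable fun x : Fin n → β => Fin.partialSum x m := by
  induction m using Fin.induction with
  | zero => simp
  | succ m ih => simp only [Fin.partialSum_succ]; fun_prop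

end PartialSums

/-! ### Sums of an i.i.d. sequence over blocks and up to random indices. -/

section IID

variable {Ω β : Type*} [MeasurableSpace Ω] {P : Measure Ω} [AddCommMonoid β] [MeasurableSpace β]
  [MeasurableAdd₂ β] {V : ℕ → Ω → β}

/-- The reindexed family has a product law over pairs; currying it makes the blocks independent, and
equal marginals make the offset of a block irrelevant. -/
theorem map_block_sums {n : ℕ} (hm : ∀ i, Measurable (V i)) (hV : iIndepFun V P)
    (hid : ∀ i, P.map (V i) = P.map (V 0)) (a : Fin n → ℕ) :
    P.map (fun ω l => ∑ j ∈ Finset.range (a l), V (Fin.partialSum a l.castSucc + j) ω) =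
      Measure.pi fun l => P.map fun ω => ∑ i ∈ Finset.range (a l), V i ω := by
  have := hV.isProbabilityMeasure
  have hprob : IsProbabilityMeasure (P.map (V 0)) := Measure.isProbabilityMeasure_map (hm 0).aemeasurable
  set μ := P.map (V 0) with hμ
  have hsum : ∀ b : ℕ, Measurable fun x : Fin b → β => ∑ j, x j := fun b => by fun_prop
  have hone : ∀ b : ℕ, (P.map fun ω => ∑ i ∈ Finset.range b, V i ω) =
      (Measure.infinitePi fun _ : Fin b => μ).map fun x => ∑ j, x j := by
    intro b
    have h1 := (hV.precomp (g := fun i : Fin b => (i : ℕ))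
      Fin.val_injective).map_fun_eq_infinitePi_map (fun i => hm _)
    simp only [hid] at h1
    rw [← h1, Measure.map_map (hsum b) (by fun_prop)]
    simp only [Function.comp_def, Finset.sum_range]
  have h2 := (hV.precomp (block_injective a)).map_fun_eq_infinitePi_map (fun i => hm _)
  simp only [hid] at h2
  have h3 := Measure.infinitePi_map_piCurry (fun (l : Fin n) (_ : Fin (a l)) => μ)
  rw [← h2, Measure.map_map (by fun_prop) (by fun_prop)] at h3
  have hp : ∀ l : Fin n, IsProbabilityMeasure
      (((Measure.infinitePi fun _ : Fin (a l) => μ).map fun x => ∑ j, x j)) :=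
    fun l => Measure.isProbabilityMeasure_map (hsum _).aemeasurable
  simp only [hone]
  rw [← Measure.infinitePi_eq_pi, ← Measure.infinitePi_map_pi _ (fun l => hsum (a l)), ← h3,
    Measure.map_map (by fun_prop) (by fun_prop)]
  congr 1
  funext ω l
  simp [Finset.sum_range, Sigma.curry]

/-- Decomposition of the law of sums stopped at independent random indices. -/
theorem measure_stopped_sums {n : ℕ} (hm : ∀ i, Measurable (V i)) (hV : iIndepFun V P)
    (hid : ∀ i, P.map (V i) = P.map (V 0)) {C : Fin (n + 1) → Ω → ℕ}
    (hC : ∀ l, Measurable (C l)) (hC0 : ∀ᵐ ω ∂P, C 0 ω = 0)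
    (hCmono : ∀ᵐ ω ∂P, Monotone fun l => C l ω)
    (hind : IndepFun (fun ω i => V i ω) (fun ω l => C l ω) P)
    {B : Set (Fin n → β)} (hB : MeasurableSet B) :
    P {ω | (fun l : Fin n => ∑ i ∈ Finset.range (C l.succ ω), V i ω) ∈ B} =
      ∑' a : Fin n → ℕ, P {ω | ∀ l, C l ω = Fin.partialSum a l} *
        Measure.pi (fun l => P.map fun ω => ∑ i ∈ Finset.range (a l), V i ω)
          {x | (fun l : Fin n => Fin.partialSum x l.succ) ∈ B} := by
  have hps : Measurable fun (x : Fin n → β) (l : Fin n) => Fin.partialSum x l.succ :=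
    measurable_pi_lambda _ fun l => measurable_partialSum _
  have hcount : ∀ a : Fin n → ℕ, P ({ω | (fun l : Fin n => ∑ i ∈ Finset.range (C l.succ ω), V i ω) ∈ B} ∩
      {ω | ∀ l, C l ω = Fin.partialSum a l}) = P {ω | ∀ l, C l ω = Fin.partialSum a l} *
        Measure.pi (fun l => P.map fun ω => ∑ i ∈ Finset.range (a l), V i ω)
          {x | (fun l : Fin n => Fin.partialSum x l.succ) ∈ B} := by
    intro a
    -- Once the indices are fixed, the sums have deterministic ranges, so the event splits into one
    -- about `V` and one about `C`.
    have hset : ({ω | (fun l : Fin n => ∑ i ∈ Finset.range (C l.succ ω), V i ω) ∈ B} ∩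
        {ω | ∀ l, C l ω = Fin.partialSum a l}) =
        ((fun ω i => V i ω) ⁻¹' {v : ℕ → β | (fun l : Fin n =>
          ∑ i ∈ Finset.range (Fin.partialSum a l.succ), v i) ∈ B}) ∩
        ((fun ω l => C l ω) ⁻¹' {Fin.partialSum a}) := by
      ext ω
      simp only [mem_inter_iff, mem_ofPred_eq, mem_preimage, mem_singleton_iff, funext_iff]
      constructor
      · rintro ⟨h1, h2⟩
        simp only [h2] at h1
        exact ⟨h1, h2⟩
      · rintro ⟨h1, h2⟩
        simp only [h2]
        exact ⟨h1, fun _ => trivial⟩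
    have hms : MeasurableSet {v : ℕ → β | (fun l : Fin n =>
          ∑ i ∈ Finset.range (Fin.partialSum a l.succ), v i) ∈ B} :=
      (measurable_pi_lambda _ fun l => by fun_prop :
        Measurable fun (v : ℕ → β) (l : Fin n) =>
          ∑ i ∈ Finset.range (Fin.partialSum a l.succ), v i) hB
    rw [hset, hind.measure_inter_preimage_eq_mul _ _ hms (measurableSet_singleton _), mul_comm]
    congr 1
    · congr 1
      ext ω
      simp [funext_iff]
    · rw [← map_block_sums hm hV hid a, Measure.map_apply
        (measurable_pi_lambda _ fun l => Finset.measurable_sum _ fun j _ => hm _)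
        (show MeasurableSet {x : Fin n → β | (fun l : Fin n => Fin.partialSum x l.succ) ∈ B} from
          hps hB)]
      simp only [sum_range_partialSum]
      rfl
  have hae : ∀ᵐ ω ∂P, ∃ a : Fin n → ℕ, ∀ l, C l ω = Fin.partialSum a l := by
    filter_upwards [hC0, hCmono] with ω h0 hmono
    -- Monotonicity keeps this natural subtraction from truncating.
    refine ⟨fun l => C l.succ ω - C l.castSucc ω, fun l => ?_⟩
    refine congrFun ((eq_partialSum_iff (fun l => C l ω) _).2 ⟨h0, fun l => ?_⟩) l
    have : C l.castSucc ω ≤ C l.succ ω := hmono (Fin.castSucc_lt_succ).le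
    omega
  have hCm : ∀ a : Fin n → ℕ, MeasurableSet {ω | ∀ l, C l ω = Fin.partialSum a l} := by
    intro a
    rw [ofPred_forall]
    exact MeasurableSet.iInter fun l => hC l (measurableSet_singleton _)
  have hCd : Pairwise (Function.onFun Disjoint fun a : Fin n → ℕ =>
      {ω | ∀ l, C l ω = Fin.partialSum a l}) := by
    intro a b hab
    refine Set.disjoint_left.2 fun ω h1 h2 => hab (partialSum_succ_injective ?_)
    funext l
    exact (h1 _).symm.trans (h2 _)
  have hcl : ∀ l, Measurable fun ω => ∑ i ∈ Finset.range (C l ω), V i ω := fun l =>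
    (measurable_from_prod_countable_right (f := fun p : ℕ × Ω => ∑ i ∈ Finset.range p.1, V i p.2)
      fun b => by dsimp only; fun_prop).comp ((hC l).prodMk measurable_id)
  have hE : MeasurableSet {ω | (fun l : Fin n => ∑ i ∈ Finset.range (C l.succ ω), V i ω) ∈ B} :=
    (measurable_pi_lambda _ fun l => hcl _) hB
  simp only [← hcount]
  rw [← measure_iUnion (fun a b hab => (hCd hab).mono inter_subset_right inter_subset_right)
    (fun a => hE.inter (hCm a)), ← inter_iUnion]
  refine measure_congr ?_
  filter_upwards [hae] with ω hω
  refine propext ⟨fun h => ⟨h, mem_iUnion.2 hω⟩, fun h => h.1⟩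

end IID

/-! ### Convolution powers, their densities, and the iterated integral. -/

section Convolution

instance isProbabilityMeasure_lawConvPow (H : Measure ℝ) [IsProbabilityMeasure H] (j : ℕ) :
    IsProbabilityMeasure (lawConvPow H j) := by
  induction j with
  | zero => unfold lawConvPow; infer_instance
  | succ j ih => unfold lawConvPow; infer_instance

theorem map_sum_range_eq_lawConvPow {Ω : Type*} [MeasurableSpace Ω] {P : Measure Ω}
    {H : Measure ℝ} {Y : ℕ → Ω → ℝ} (hm : ∀ i, Measurable (Y i)) (hY : iIndepFun Y P)
    (hlaw : ∀ i, P.map (Y i) = H) (j : ℕ) :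
    (P.map fun ω => ∑ i ∈ Finset.range j, Y i ω) = lawConvPow H j := by
  have := hY.isProbabilityMeasure
  induction j with
  | zero => simp [lawConvPow]
  | succ j ih =>
    have h := IndepFun.map_add_eq_map_conv_map
      (show Measurable (∑ i ∈ Finset.range j, Y i) by fun_prop) (hm j)
      (hY.indepFun_sum_range_succ hm j)
    rw [lawConvPow, ← ih, ← hlaw j]
    convert h using 2
    · funext ω
      simp [Finset.sum_range_succ]
    · congr 1
      funext ω
      simp

/-- Tonelli in the first coordinate; the shift `c` carries the sum of the variables already
integrated, which is what makes the induction close. -/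
theorem iteratedIntegral_eq_pi {n : ℕ} (K : Fin n → Measure ℝ) [∀ i, IsProbabilityMeasure (K i)]
    (y : Fin n → ℝ) (c : ℝ) :
    iteratedIntegral K y c = Measure.pi K {x | ∀ l : Fin n, c + Fin.partialSum x l.succ ≤ y l} := by
  induction n generalizing c with
  | zero => simp [iteratedIntegral]
  | succ n ih =>
    have hmeas : MeasurableSet {x : Fin (n + 1) → ℝ | ∀ l : Fin (n + 1),
        c + Fin.partialSum x l.succ ≤ y l} := by
      rw [ofPred_forall]
      refine MeasurableSet.iInter fun l => measurableSet_le
        (measurable_const.add (measurable_partialSum _)) measurable_const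
    have hmp := (measurePreserving_piFinSuccAbove K 0).symm
    rw [← hmp.measure_preimage_equiv, Measure.prod_apply (hmp.measurable hmeas), iteratedIntegral,
      ← lintegral_indicator measurableSet_Iic]
    have hcons : ∀ (x : ℝ) (z : Fin n → ℝ) (j : Fin (n + 1)),
        Fin.partialSum (Fin.consEquiv (fun _ : Fin (n + 1) => ℝ) (x, z)) j.succ =
          x + Fin.partialSum z j := fun x z j => by
      rw [Fin.partialSum_succ']
      simp [Fin.consEquiv]
    refine lintegral_congr fun x => ?_
    by_cases hx : x ≤ y 0 - c
    · rw [indicator_of_mem (by exact hx), ih]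
      congr 1
      ext z
      simp only [mem_ofPred_eq, mem_preimage, MeasurableEquiv.piFinSuccAbove_symm_apply,
        Fin.forall_fin_succ (n := n), Fin.insertNthEquiv_zero,
        hcons, Fin.partialSum_zero, add_zero, add_assoc]
      exact ⟨fun h => ⟨by linarith, h⟩, fun h => h.2⟩
    -- Here the first constraint already fails, so the section is empty.
    · rw [indicator_of_notMem (by exact hx)]
      symm
      convert measure_empty (μ := Measure.pi fun j => K (Fin.succAbove 0 j))
      refine eq_empty_of_forall_notMem fun z hz => hx ?_
      have h0 := hz 0
      simp only [MeasurableEquiv.piFinSuccAbove_symm_apply, Fin.insertNthEquiv_zero, hcons,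
        Fin.partialSum_zero, add_zero] at h0
      linarith

theorem lawConvPow_withDensity_volume {h : ℝ → ℝ≥0∞} (hh : Measurable h) :
    lawConvPow (volume.withDensity h) = densityConvMeasure volume h := by
  have hmeas : ∀ j, Measurable (densityConvPow volume h j) := by
    intro j
    induction j with
    | zero => exact hh
    | succ j ih => exact measurable_lconvolution _ ih hh
  funext j
  cases j with
  | zero => rfl
  | succ j =>
    induction j with
    | zero => simp [lawConvPow, densityConvMeasure, densityConvPow]
    | succ j ih =>
      rw [lawConvPow, ih, densityConvMeasure, conv_withDensity_eq_lconvolution (hmeas j) hh]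
      rfl

theorem withDensity_count {α : Type*} [MeasurableSpace α] [MeasurableSingletonClass α]
    (f : α → ℝ≥0∞) :
    Measure.count.withDensity f = Measure.sum fun x => f x • Measure.dirac x := by
  ext s hs
  rw [withDensity_apply _ hs, ← lintegral_indicator hs, lintegral_count, Measure.sum_apply _ hs]
  refine tsum_congr fun x => ?_
  by_cases hx : x ∈ s <;> simp [hx, hs]

/-- Counting measure on ℝ is not s-finite, so the integrals are written as series in `ℝ≥0∞`, where
sums interchange freely; then z is translated by x. -/
theorem conv_withDensity_count (f g : ℝ → ℝ≥0∞)
    [SFinite (Measure.count.withDensity g)] :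
    (Measure.count.withDensity f).conv (Measure.count.withDensity g) =
      Measure.count.withDensity (lconvolution f g Measure.count) := by
  refine Measure.ext_of_lintegral _ fun φ hφ => ?_
  rw [Measure.lintegral_conv hφ]
  simp only [withDensity_count, lintegral_sum_measure, lintegral_smul_measure, lintegral_dirac,
    lconvolution_def, lintegral_count, smul_eq_mul, ← ENNReal.tsum_mul_left, ← ENNReal.tsum_mul_right]
  rw [ENNReal.tsum_comm (f := fun z x => f x * g (-x + z) * φ z)]
  refine tsum_congr fun x => ?_
  rw [← (Equiv.addLeft x).tsum_eq fun z => f x * g (-x + z) * φ z]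
  simp [mul_assoc]

theorem lawConvPow_withDensity_count {h : ℝ → ℝ≥0∞}
    [IsProbabilityMeasure (Measure.count.withDensity h)] :
    lawConvPow (Measure.count.withDensity h) = densityConvMeasure Measure.count h := by
  funext j
  cases j with
  | zero => rfl
  | succ j =>
    induction j with
    | zero => simp [lawConvPow, densityConvMeasure, densityConvPow]
    | succ j ih =>
      rw [lawConvPow, ih, densityConvMeasure, conv_withDensity_count]
      rfl

end Convolution

/-! ### Freezing independent random times. -/

section TimeChange

open Filter Topology

/-- `A'` need not be measurable: as an a.e. limit it is null-measurable and may be replaced by its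
measurable hull. -/
theorem tendsto_measure_of_ae_eventually_mem_iff {Ω : Type*} [MeasurableSpace Ω] {P : Measure Ω}
    [IsFiniteMeasure P] {A : ℕ → Set Ω} {A' : Set Ω} (hA : ∀ r, MeasurableSet (A r))
    (h : ∀ᵐ ω ∂P, ∀ᶠ r in atTop, ω ∈ A r ↔ ω ∈ A') :
    Tendsto (fun r => P (A r)) atTop (𝓝 (P A')) := by
  have hnull : NullMeasurableSet A' P :=
    nullMeasurableSet_of_tendsto_indicator atTop (fun r => (hA r).nullMeasurableSet) h
  rw [← measure_congr hnull.toMeasurable_ae_eq]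
  refine tendsto_measure_of_ae_tendsto_indicator_of_isFiniteMeasure atTop
    (measurableSet_toMeasurable _ _) hA ?_
  filter_upwards [h, hnull.toMeasurable_ae_eq.mem_iff] with ω h1 h2
  filter_upwards [h1] with r hr
  rw [hr, h2]

/-- Approximation of a time from the right, strictly, on a grid of mesh `1 / (r + 1)`. -/
noncomputable def gridTime (r : ℕ) (s : ℝ≥0) : ℝ≥0 := ((⌊(r + 1) * s⌋₊ : ℝ≥0) + 1) / (r + 1)

theorem tendsto_gridTime (s : ℝ≥0) : Tendsto (fun r => gridTime r s) atTop (𝓝[≥] s) := by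
  have hle : ∀ r, s ≤ gridTime r s := fun r => by
    rw [gridTime, le_div_iff₀ (by positivity), mul_comm]
    exact (Nat.lt_floor_add_one _).le
  refine tendsto_nhdsWithin_iff.2 ⟨?_, Eventually.of_forall hle⟩
  have hlim : Tendsto (fun r : ℕ => s + 1 / ((r : ℝ≥0) + 1)) atTop (𝓝 s) := by
    simpa using tendsto_const_nhds.add (tendsto_one_div_add_atTop_nhds_zero_nat (𝕜 := ℝ≥0))
  refine tendsto_of_tendsto_of_tendsto_of_le_of_le tendsto_const_nhds hlim hle fun r => ?_
  have hr : (0 : ℝ≥0) < (r : ℝ≥0) + 1 := by positivity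
  have hfl : (⌊((r : ℝ≥0) + 1) * s⌋₊ : ℝ≥0) ≤ ((r : ℝ≥0) + 1) * s := Nat.floor_le (by positivity)
  change gridTime r s ≤ _
  rw [gridTime, add_div]
  gcongr
  rwa [div_le_iff₀ hr, mul_comm s]

/-- Evaluating a path at an arbitrary time is not jointly measurable for the product σ-algebra. At a
grid time it is, because the time enters only through an integer. -/
theorem measurable_eval_gridTime (r : ℕ) :
    Measurable fun p : ℝ≥0 × (ℝ≥0 → ℕ) => p.2 (gridTime r p.1) := by
  have h : Measurable fun p : ℕ × (ℝ≥0 → ℕ) => p.2 (((p.1 : ℝ≥0) + 1) / (r + 1)) :=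
    measurable_from_prod_countable_right fun b => measurable_pi_apply (((b : ℝ≥0) + 1) / (r + 1))
  exact h.comp ((Nat.measurable_floor.comp (measurable_const.mul measurable_fst)).prodMk
    measurable_snd)

variable {Ω E : Type*} [MeasurableSpace Ω] [MeasurableSpace E] {P : Measure Ω}
  [IsProbabilityMeasure P] {m : ℕ} {M : ℝ≥0 → Ω → ℕ} {W : Ω → E}

theorem measurableSet_gridTime {B : Set ((Fin m → ℕ) × E)} (hB : MeasurableSet B) (r : ℕ) :
    MeasurableSet {p : (Fin m → ℝ≥0) × ((ℝ≥0 → ℕ) × E) |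
      ((fun l => p.2.1 (gridTime r (p.1 l))), p.2.2) ∈ B} := by
  refine (?_ : Measurable fun p : (Fin m → ℝ≥0) × ((ℝ≥0 → ℕ) × E) =>
    ((fun l => p.2.1 (gridTime r (p.1 l))), p.2.2)) hB
  refine Measurable.prodMk (measurable_pi_lambda _ fun l => ?_)
    (measurable_snd.comp measurable_snd)
  exact (measurable_eval_gridTime r).comp (f := fun p : (Fin m → ℝ≥0) × ((ℝ≥0 → ℕ) × E) =>
    (p.1 l, p.2.1)) (((measurable_pi_apply l).comp measurable_fst).prodMk
      (measurable_fst.comp measurable_snd))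

/-- A right-continuous integer-valued path is constant just to the right of each time, so for large
`r` the grid values are exact. -/
theorem tendsto_measure_gridTime (hM : ∀ t, Measurable (M t)) (hW : Measurable W)
    (hrc : ∀ᵐ ω ∂P, ∀ t, ∀ᶠ s in 𝓝[≥] t, M s ω = M t ω)
    {B : Set ((Fin m → ℕ) × E)} (hB : MeasurableSet B) {T : Ω → Fin m → ℝ≥0}
    (hT : Measurable T) :
    Tendsto (fun r => P {ω | ((fun l => M (gridTime r (T ω l)) ω), W ω) ∈ B}) atTop
      (𝓝 (P {ω | ((fun l => M (T ω l) ω), W ω) ∈ B})) := by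
  refine tendsto_measure_of_ae_eventually_mem_iff (fun r => ?_) ?_
  · exact (hT.prodMk ((measurable_pi_lambda (fun ω t => M t ω) hM).prodMk hW))
      (measurableSet_gridTime hB r)
  · filter_upwards [hrc] with ω hω
    have : ∀ᶠ r in atTop, ∀ l, M (gridTime r (T ω l)) ω = M (T ω l) ω :=
      eventually_all.2 fun l => (tendsto_gridTime _).eventually (hω _)
    filter_upwards [this] with r hr
    simp only [hr]

omit [IsProbabilityMeasure P] in
theorem measure_gridTime_const (hM : ∀ t, Measurable (M t)) (hW : Measurable W)
    {B : Set ((Fin m → ℕ) × E)} (hB : MeasurableSet B) (r : ℕ) (s : Fin m → ℝ≥0) :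
    P {ω | ((fun l => M (gridTime r (s l)) ω), W ω) ∈ B} =
      P.map (fun ω => ((fun t => M t ω), W ω)) (Prod.mk s ⁻¹'
        {p : (Fin m → ℝ≥0) × ((ℝ≥0 → ℕ) × E) |
          ((fun l => p.2.1 (gridTime r (p.1 l))), p.2.2) ∈ B}) := by
  rw [Measure.map_apply ((measurable_pi_lambda (fun ω t => M t ω) hM).prodMk hW)
    (measurable_prodMk_left (measurableSet_gridTime hB r))]
  rfl

theorem measurable_measure_times (hM : ∀ t, Measurable (M t)) (hW : Measurable W)
    (hrc : ∀ᵐ ω ∂P, ∀ t, ∀ᶠ s in 𝓝[≥] t, M s ω = M t ω)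
    {B : Set ((Fin m → ℕ) × E)} (hB : MeasurableSet B) :
    Measurable fun s : Fin m → ℝ≥0 => P {ω | ((fun l => M (s l) ω), W ω) ∈ B} := by
  refine measurable_of_tendsto_metrizable (f := fun r (s : Fin m → ℝ≥0) =>
    P {ω | ((fun l => M (gridTime r (s l)) ω), W ω) ∈ B}) (fun r => ?_)
    (tendsto_pi_nhds.2 fun s => tendsto_measure_gridTime hM hW hrc hB measurable_const)
  simp only [measure_gridTime_const hM hW hB]
  exact measurable_measure_prodMk_left (measurableSet_gridTime hB r)

/-- Conditioning on independent random times amounts to freezing them. -/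
theorem measure_random_times (hM : ∀ t, Measurable (M t)) (hW : Measurable W)
    (hrc : ∀ᵐ ω ∂P, ∀ t, ∀ᶠ s in 𝓝[≥] t, M s ω = M t ω)
    {B : Set ((Fin m → ℕ) × E)} (hB : MeasurableSet B) {T : Ω → Fin m → ℝ≥0}
    (hT : Measurable T) (hind : IndepFun T (fun ω => ((fun t => M t ω), W ω)) P) :
    P {ω | ((fun l => M (T ω l) ω), W ω) ∈ B} =
      ∫⁻ ω, P {ω' | ((fun l => M (T ω l) ω'), W ω') ∈ B} ∂P := by
  have hMW : Measurable fun ω => ((fun t => M t ω), W ω) :=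
    (measurable_pi_lambda (fun ω t => M t ω) hM).prodMk hW
  -- On the grid the event is jointly measurable, and independence makes the joint law a product, so
  -- Tonelli applies.
  have hgrid : ∀ r, P {ω | ((fun l => M (gridTime r (T ω l)) ω), W ω) ∈ B} =
      ∫⁻ ω, P {ω' | ((fun l => M (gridTime r (T ω l)) ω'), W ω') ∈ B} ∂P := by
    intro r
    simp only [measure_gridTime_const hM hW hB]
    rw [← lintegral_map (measurable_measure_prodMk_left (measurableSet_gridTime hB r)) hT,
      ← Measure.prod_apply (measurableSet_gridTime hB r),
      ← hind.map_prod_eq_prod_map_map hT.aemeasurable hMW.aemeasurable,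
      Measure.map_apply (hT.prodMk hMW) (measurableSet_gridTime hB r)]
    rfl
  refine tendsto_nhds_unique (tendsto_measure_gridTime hM hW hrc hB hT) ?_
  simp only [hgrid]
  refine tendsto_lintegral_of_dominated_convergence (fun _ => 1) (fun r => ?_)
    (fun r => Eventually.of_forall fun ω => prob_le_one) (by simp)
    (Eventually.of_forall fun ω => tendsto_measure_gridTime hM hW hrc hB measurable_const)
  simp only [measure_gridTime_const hM hW hB]
  exact (measurable_measure_prodMk_left (measurableSet_gridTime hB r)).comp hT

end TimeChange

/-! ### Increments of the Poisson process and of the process of order `k`. -/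

section OrderK

open Filter Topology

variable {Ω : Type*} [MeasurableSpace Ω] {P : Measure Ω} {k : ℕ} {lam : ℝ≥0}
  {N : ℝ≥0 → Ω → ℕ} {X : ℕ → Ω → ℕ}

theorem IsPoissonProcess.measure_increment {r : ℝ≥0} (hN : IsPoissonProcess N r P)
    (s h : ℝ≥0) (a : ℕ) :
    P {ω | (N (s + h) ω : ℝ) - N s ω = a} = P {ω | N h ω = a} := by
  have key : ∀ u : ℝ≥0, P {ω | (N (u + h) ω : ℝ) - N u ω = a} =
      (poissonMeasure (r * h)).map (Nat.cast : ℕ → ℝ) {(a : ℝ)} := fun u => by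
    rw [← (hN.law u h).map_eq, Measure.map_apply_of_aemeasurable (hN.law u h).aemeasurable
      (measurableSet_singleton _)]
    rfl
  rw [key s, ← key 0]
  refine measure_congr ?_
  filter_upwards [hN.zero] with ω hω
  refine propext (?_ : (N (0 + h) ω : ℝ) - N 0 ω = a ↔ N h ω = a)
  simp [hω]

theorem IsPoissonProcess.measure_times {r : ℝ≥0} (hN : IsPoissonProcess N r P) {n : ℕ}
    {s : Fin (n + 1) → ℝ≥0} (hs : Monotone s) (hs0 : s 0 = 0) (a : Fin n → ℕ) :
    P {ω | ∀ l, N (s l) ω = Fin.partialSum a l} =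
      ∏ l : Fin n, P {ω | N (s l.succ - s l.castSucc) ω = a l} := by
  have hincr : ∀ l : Fin n, P {ω | N (s l.succ - s l.castSucc) ω = a l} =
      P ((fun ω => (N (s l.succ) ω : ℝ) - N (s l.castSucc) ω) ⁻¹' {(a l : ℝ)}) := fun l => by
    rw [← hN.measure_increment (s l.castSucc),
      add_tsub_cancel_of_le (hs (Fin.castSucc_lt_succ).le)]
    rfl
  simp only [hincr]
  have h := (hN.indep n s hs).measure_inter_preimage_eq_mul (Finset.univ)
    (sets := fun l => {(a l : ℝ)}) (fun l _ => measurableSet_singleton _)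
  rw [← h]
  refine measure_congr (Filter.eventuallyEq_set.2 ?_)
  filter_upwards [hN.zero] with ω hω
  rw [← funext_iff (f := fun l => N (s l) ω), eq_partialSum_iff (fun l => N (s l) ω)]
  simp only [hs0, hω, true_and, Finset.mem_univ, iInter_true, mem_iInter, mem_preimage,
    mem_singleton_iff, sub_eq_iff_eq_add]
  refine forall_congr' fun l => ?_
  rw [add_comm]
  exact_mod_cast Iff.rfl

theorem IsPPoK.measurable_orderKProcess (hX : IsPPoK k lam N X P) (t : ℝ≥0) :
    Measurable (orderKProcess N X t) :=
  (measurable_from_prod_countable_right (f := fun p : ℕ × Ω => ∑ i ∈ Finset.range p.1, X i p.2)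
    fun b => by have := hX.measurable; dsimp only; fun_prop).comp
    ((hX.poisson.measurable t).prodMk measurable_id)

theorem IsPPoK.orderKProcess_zero (hX : IsPPoK k lam N X P) :
    ∀ᵐ ω ∂P, orderKProcess N X 0 ω = 0 := by
  filter_upwards [hX.poisson.zero] with ω hω
  simp [orderKProcess, hω]

theorem IsPPoK.monotone_orderKProcess (hX : IsPPoK k lam N X P) :
    ∀ᵐ ω ∂P, Monotone fun t => orderKProcess N X t ω := by
  filter_upwards [hX.poisson.paths] with ω hω s t hst
  exact Finset.sum_le_sum_of_subset (Finset.range_mono (hω.1 hst))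

theorem IsPPoK.eventually_orderKProcess_eq (hX : IsPPoK k lam N X P) :
    ∀ᵐ ω ∂P, ∀ t, ∀ᶠ s in 𝓝[≥] t, orderKProcess N X s ω = orderKProcess N X t ω := by
  filter_upwards [hX.poisson.paths] with ω hω t
  have h : ∀ᶠ s in 𝓝[≥] t, N s ω = N t ω := by
    have := hω.2 t
    rwa [ContinuousWithinAt, nhds_discrete, tendsto_pure] at this
  filter_upwards [h] with s hs
  simp [orderKProcess, hs]

/-- The process of order `k` has independent and stationary increments. -/
theorem IsPPoK.measure_times (hX : IsPPoK k lam N X P) {n : ℕ}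
    {s : Fin (n + 1) → ℝ≥0} (hs : Monotone s) (hs0 : s 0 = 0) (j : Fin n → ℕ) :
    P {ω | ∀ l, orderKProcess N X (s l) ω = Fin.partialSum j l} =
      ∏ l : Fin n, P {ω | orderKProcess N X (s l.succ - s l.castSucc) ω = j l} := by
  have := hX.indep.isProbabilityMeasure
  have hid : ∀ i, P.map (X i) = P.map (X 0) := fun i => (hX.law i).map_eq.trans (hX.law 0).map_eq.symm
  -- Summing over the numbers of Poisson jumps in the intervals, the series factorizes, and each
  -- factor depends only on the length of its interval.
  have key : ∀ {n : ℕ} {s : Fin (n + 1) → ℝ≥0}, Monotone s → s 0 = 0 → ∀ j : Fin n → ℕ,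
      P {ω | ∀ l, orderKProcess N X (s l) ω = Fin.partialSum j l} =
        ∏ l : Fin n, ∑' i, P {ω | N (s l.succ - s l.castSucc) ω = i} *
          P.map (fun ω => ∑ m ∈ Finset.range i, X m ω) {j l} := by
    intro n s hs hs0 j
    have hset : {x : Fin n → ℕ | (fun l : Fin n => Fin.partialSum x l.succ) ∈
        ({fun l : Fin n => Fin.partialSum j l.succ} : Set (Fin n → ℕ))} = univ.pi fun l => {j l} := by
      ext x
      rw [univ_pi_singleton]
      exact partialSum_succ_injective.eq_iff
    have h : P {ω | (fun l : Fin n => orderKProcess N X (s l.succ) ω) ∈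
        ({fun l : Fin n => Fin.partialSum j l.succ} : Set (Fin n → ℕ))} =
        ∑' a : Fin n → ℕ, P {ω | ∀ l, N (s l) ω = Fin.partialSum a l} *
          Measure.pi (fun l => P.map fun ω => ∑ m ∈ Finset.range (a l), X m ω)
            (univ.pi fun l => {j l}) := by
      rw [← hset]
      exact measure_stopped_sums (C := fun l => N (s l)) hX.measurable hX.indep hid
        (fun l => hX.poisson.measurable _) (by rw [hs0]; exact hX.poisson.zero)
        (by filter_upwards [hX.poisson.paths] with ω hω using hω.1.comp hs)
        (hX.indep_poisson.comp measurable_id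
          (measurable_pi_lambda (fun (x : ℝ≥0 → ℕ) l => x (s l)) fun l => measurable_pi_apply _))
        (measurableSet_singleton _)
    have hp : ∀ i, IsProbabilityMeasure (P.map fun ω => ∑ m ∈ Finset.range i, X m ω) := fun i =>
      Measure.isProbabilityMeasure_map
        (Finset.measurable_sum _ fun m _ => hX.measurable m).aemeasurable
    simp only [Measure.pi_pi, hX.poisson.measure_times hs hs0, ← Finset.prod_mul_distrib] at h
    rw [← tsum_prod_eq_prod_tsum fun l i => P {ω | N (s l.succ - s l.castSucc) ω = i} *
          P.map (fun ω => ∑ m ∈ Finset.range i, X m ω) {j l}, ← h]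
    refine measure_congr (Filter.eventuallyEq_set.2 ?_)
    filter_upwards [hX.orderKProcess_zero] with ω hω
    rw [mem_singleton_iff, funext_iff, Fin.forall_fin_succ]
    simp [hs0, hω]
  rw [key hs hs0]
  refine Finset.prod_congr rfl fun l _ => ?_
  set h := s l.succ - s l.castSucc
  -- The case of the two times 0, h of `key` identifies the factor as a probability at time h.
  have hmono : Monotone (Fin.cons 0 fun _ => h : Fin 2 → ℝ≥0) :=
    Fin.monotone_iff_le_succ.2 fun i => by fin_cases i; simp
  have h1 := key hmono rfl fun _ => j l
  simp only [Fin.prod_univ_one, Fin.cons_succ, Fin.castSucc_zero, Fin.cons_zero, tsub_zero] at h1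
  rw [← h1]
  refine measure_congr (Filter.eventuallyEq_set.2 ?_)
  filter_upwards [hX.orderKProcess_zero] with ω hω
  rw [Fin.forall_fin_succ, Fin.forall_fin_one, Fin.partialSum_succ]
  simp [hω]

end OrderK

/-! ### The compound process at deterministic and at subordinated times. -/

section Compound

variable {Ω : Type*} [MeasurableSpace Ω] {P : Measure Ω} {k : ℕ} {lam : ℝ≥0} {H : Measure ℝ}
  {N : ℝ≥0 → Ω → ℕ} {X : ℕ → Ω → ℕ} {Y : ℕ → Ω → ℝ}

/-- Finite-dimensional distributions of the compound process at deterministic times. -/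
theorem IsCPPoK.measure_times [IsProbabilityMeasure H] (hZ : IsCPPoK k lam H N X Y P) {n : ℕ}
    {s : Fin (n + 1) → ℝ≥0} (hs : Monotone s) (hs0 : s 0 = 0) (y : Fin n → ℝ) :
    P {ω | ∀ l : Fin n, compoundProcess N X Y (s l.succ) ω ≤ y l} =
      ∑' j : Fin n → ℕ,
        (∏ l : Fin n, P {ω | orderKProcess N X (s l.succ - s l.castSucc) ω = j l}) *
          iteratedIntegral (fun m => lawConvPow H (j m)) y 0 := by
  have hB : MeasurableSet {v : Fin n → ℝ | ∀ l, v l ≤ y l} := by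
    rw [ofPred_forall]
    exact MeasurableSet.iInter fun l => measurableSet_le (measurable_pi_apply l) measurable_const
  have h := measure_stopped_sums (C := fun l => orderKProcess N X (s l)) hZ.measurable hZ.indep
    (fun i => (hZ.law i).map_eq.trans (hZ.law 0).map_eq.symm)
    (fun l => hZ.ppok.measurable_orderKProcess _)
    (by rw [hs0]; exact hZ.ppok.orderKProcess_zero)
    (by filter_upwards [hZ.ppok.monotone_orderKProcess] with ω hω using hω.comp hs)
    (hZ.indep_ppok.comp measurable_id
      (measurable_pi_lambda (fun (x : ℝ≥0 → ℕ) l => x (s l)) fun l => measurable_pi_apply _)) hB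
  simp only [hZ.ppok.measure_times hs hs0,
    map_sum_range_eq_lawConvPow hZ.measurable hZ.indep fun i => (hZ.law i).map_eq] at h
  simp only [iteratedIntegral_eq_pi, zero_add]
  exact h

theorem timeIncr_eq_cons {n : ℕ} (t : Fin n → ℝ≥0) (l : Fin n) :
    timeIncr t l = (Fin.cons 0 t : Fin (n + 1) → ℝ≥0) l.succ -
      (Fin.cons 0 t : Fin (n + 1) → ℝ≥0) l.castSucc := by
  cases n with
  | zero => exact l.elim0
  | succ n =>
    cases l using Fin.cases with
    | zero => simp [timeIncr]
    | succ l =>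
      rw [Fin.cons_succ, Fin.castSucc_succ, Fin.cons_succ, timeIncr, if_pos (by simp)]
      rfl

theorem monotone_cons_zero {n : ℕ} {t : Fin n → ℝ≥0} (ht : Monotone t) :
    Monotone (Fin.cons 0 t : Fin (n + 1) → ℝ≥0) := by
  refine Fin.monotone_iff_le_succ.2 fun l => ?_
  cases n with
  | zero => exact l.elim0
  | succ n =>
    cases l using Fin.cases with
    | zero => simp
    | succ l =>
      rw [Fin.cons_succ, Fin.castSucc_succ, Fin.cons_succ]
      exact ht (Fin.castSucc_lt_succ).le

variable {S : ℝ≥0 → Ω → ℝ≥0}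

/-- The law of `Z(S(t_1)), ..., Z(S(t_n))` for a subordinator `S` independent of `Z`. -/
theorem IsCPPoK.measure_subordinated [IsProbabilityMeasure P] [IsProbabilityMeasure H]
    (hZ : IsCPPoK k lam H N X Y P) (hS : IsSubordinator S P)
    (hSZ : IndepFun (fun ω t => S t ω)
      (fun ω => ((fun t => orderKProcess N X t ω : ℝ≥0 → ℕ), (fun i => Y i ω : ℕ → ℝ))) P)
    {q : ℕ → ℝ≥0 → ℝ≥0∞} (hq : ∀ j t, q j t = P {ω | orderKProcess N X (S t ω) ω = j})
    {n : ℕ} {t : Fin n → ℝ≥0} (ht : Monotone t) (y : Fin n → ℝ) :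
    P {ω | ∀ i, compoundProcess N X Y (S (t i) ω) ω ≤ y i} = fddSeries q (lawConvPow H) t y := by
  have hW : Measurable fun ω i => Y i ω := measurable_pi_lambda _ hZ.measurable
  have hM := hZ.ppok.measurable_orderKProcess
  have hrc := hZ.ppok.eventually_orderKProcess_eq
  have hcoord : ∀ {m : ℕ} (u : Fin m → ℝ≥0), Measurable fun (x : ℝ≥0 → ℝ≥0) l => x (u l) :=
    fun u => measurable_pi_lambda _ fun l => measurable_pi_apply _
  have hSm : ∀ {m : ℕ} (u : Fin m → ℝ≥0), Measurable fun ω l => S (u l) ω :=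
    fun u => measurable_pi_lambda _ fun l => hS.measurable _
  have hB1 : ∀ j : ℕ, MeasurableSet {c : (Fin 1 → ℕ) × (ℕ → ℝ) | c.1 0 = j} := fun j =>
    measurableSet_eq_fun ((measurable_pi_apply 0).comp measurable_fst) measurable_const
  have hp : ∀ j, Measurable fun h : ℝ≥0 => P {ω | orderKProcess N X h ω = j} := fun j =>
    (measurable_measure_times hM hW hrc (hB1 j)).comp
      (measurable_pi_lambda (fun (h : ℝ≥0) (_ : Fin 1) => h) fun _ => measurable_id)
  have hqint : ∀ j h, q j h = ∫⁻ ω, P {ω' | orderKProcess N X (S h ω) ω' = j} ∂P := fun j h =>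
    (hq j h).trans (measure_random_times hM hW hrc (hB1 j) (hSm fun _ => h)
      (hSZ.comp (hcoord fun _ => h) measurable_id))
  -- Prepending time 0 makes every `timeIncr` a consecutive difference.
  set τ : Fin (n + 1) → ℝ≥0 := Fin.cons 0 t with hτ
  have hτm : Monotone τ := monotone_cons_zero ht
  have hBn : MeasurableSet {c : (Fin (n + 1) → ℕ) × (ℕ → ℝ) |
      ∀ l : Fin n, ∑ i ∈ Finset.range (c.1 l.succ), c.2 i ≤ y l} := by
    rw [ofPred_forall]
    refine MeasurableSet.iInter fun l => measurableSet_le ?_ measurable_const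
    have hsum : Measurable fun p : ℕ × (ℕ → ℝ) => ∑ i ∈ Finset.range p.1, p.2 i :=
      measurable_from_prod_countable_right fun b => by dsimp only; fun_prop
    exact hsum.comp (f := fun c : (Fin (n + 1) → ℕ) × (ℕ → ℝ) => (c.1 l.succ, c.2))
      (((measurable_pi_apply l.succ).comp measurable_fst).prodMk measurable_snd)
  have hincr : ∀ (l : Fin n) (j : ℕ),
      ∫⁻ ω, P {ω' | orderKProcess N X (S (τ l.succ) ω - S (τ l.castSucc) ω) ω' = j} ∂P =
        q j (timeIncr t l) := by
    intro l j
    -- Increments of `S` are real-valued in the hypotheses; `Real.toNNReal` of a real difference is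
    -- exactly the truncated difference in `ℝ≥0`.
    have hst := ((hS.stationary (τ l.castSucc) (timeIncr t l)).comp
      ((hp j).comp measurable_real_toNNReal)).lintegral_eq
    rw [timeIncr_eq_cons, ← hτ, add_tsub_cancel_of_le (hτm (Fin.castSucc_lt_succ).le)] at hst
    rw [hqint, timeIncr_eq_cons, ← hτ]
    simpa only [Function.comp_def, ← NNReal.sub_def, Real.toNNReal_coe] using hst
  calc P {ω | ∀ i, compoundProcess N X Y (S (t i) ω) ω ≤ y i}
      = ∫⁻ ω, P {ω' | ∀ l : Fin n, compoundProcess N X Y (S (τ l.succ) ω) ω' ≤ y l} ∂P :=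
        measure_random_times hM hW hrc hBn (hSm τ) (hSZ.comp (hcoord τ) measurable_id)
    _ = ∫⁻ ω, ∑' j : Fin n → ℕ, (∏ l : Fin n, P {ω' |
          orderKProcess N X (S (τ l.succ) ω - S (τ l.castSucc) ω) ω' = j l}) *
          iteratedIntegral (fun m => lawConvPow H (j m)) y 0 ∂P := by
        refine lintegral_congr_ae ?_
        filter_upwards [hS.zero, hS.paths] with ω h0 hmono
        exact hZ.measure_times (s := fun l => S (τ l) ω) (hmono.1.comp hτm) h0 y
    _ = fddSeries q (lawConvPow H) t y := by
        have hmeas : ∀ (j : Fin n → ℕ) (l : Fin n), Measurable fun ω => P {ω' |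
            orderKProcess N X (S (τ l.succ) ω - S (τ l.castSucc) ω) ω' = j l} := fun j l =>
          (hp (j l)).comp ((hS.measurable _).sub (hS.measurable _))
        rw [fddSeries, lintegral_tsum fun j => ((Finset.measurable_prod _ fun l _ =>
          hmeas j l).mul_const _).aemeasurable]
        refine tsum_congr fun j => ?_
        rw [lintegral_mul_const _ (Finset.measurable_prod _ fun l _ => hmeas j l),
          lintegral_prod_eq_prod_lintegral_of_indepFun _ _ ?_ (hmeas j)]
        · simp only [hincr]
        -- The factors are measurable functions of the separate increments of `S`, hence
        -- independent.
        · have := (hS.indep n τ hτm).comp (fun l => (fun h : ℝ≥0 =>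
            P {ω | orderKProcess N X h ω = j l}) ∘ Real.toNNReal)
            fun l => (hp (j l)).comp measurable_real_toNNReal
          simpa only [Function.comp_def, ← NNReal.sub_def] using this

end Compound

end CPPoK

theorem mainTheorem7 {Ω : Type*} [MeasurableSpace Ω] (P : Measure Ω) [IsProbabilityMeasure P]
    (k : ℕ) (hk : 1 ≤ k) (lam : ℝ≥0) (hlam : 0 < lam)
    (H : Measure ℝ) [IsProbabilityMeasure H]
    (N : ℝ≥0 → Ω → ℕ) (X : ℕ → Ω → ℕ) (Y : ℕ → Ω → ℝ)
    (hZ : CPPoK.IsCPPoK k lam H N X Y P)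
    (c₁ c₂ α₁ α₂ μ₁ μ₂ : ℝ) (hc₁ : 0 ≤ c₁) (hc₂ : 0 ≤ c₂) (hc : c₁ + c₂ = 1)
    (hα₁ : α₁ ∈ Set.Ioo (0 : ℝ) 1) (hα₂ : α₂ ∈ Set.Ioo (0 : ℝ) 1)
    (hμ₁ : 0 < μ₁) (hμ₂ : 0 < μ₂)
    (S : ℝ≥0 → Ω → ℝ≥0) (hS : CPPoK.IsMTSS c₁ c₂ α₁ α₂ μ₁ μ₂ S P)
    (hSZ : IndepFun (fun ω t => S t ω)
      (fun ω => ((fun t => CPPoK.orderKProcess N X t ω : ℝ≥0 → ℕ),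
        (fun i => Y i ω : ℕ → ℝ))) P)
    (q : ℕ → ℝ≥0 → ℝ≥0∞)
    (hq : ∀ j t, q j t = P {ω | CPPoK.orderKProcess N X (S t ω) ω = j})
    (n : ℕ) (t : Fin n → ℝ≥0) (ht : Monotone t) (y : Fin n → ℝ) :
    P {ω | ∀ i, CPPoK.compoundProcess N X Y (S (t i) ω) ω ≤ y i} =
        CPPoK.fddSeries q (CPPoK.lawConvPow H) t y ∧
      ∀ ρ : Measure ℝ, ρ = volume ∨ ρ = Measure.count →
        ∀ h : ℝ → ℝ≥0∞, Measurable h → H = ρ.withDensity h →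
          P {ω | ∀ i, CPPoK.compoundProcess N X Y (S (t i) ω) ω ≤ y i} =
            CPPoK.fddSeries q (CPPoK.densityConvMeasure ρ h) t y := by
  have hmain := hZ.measure_subordinated hS.subordinator hSZ hq ht y
  refine ⟨hmain, ?_⟩
  rintro ρ (rfl | rfl) h hh rfl
  · rw [hmain, CPPoK.lawConvPow_withDensity_volume hh]
  · rw [hmain, CPPoK.lawConvPow_withDensity_count]
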